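/- Let $n\ge 1$, let $\Omega$ be a $\sigma$-compact topological space with a positive regular Borel measure $\mu$, let $K:\Omega\to\mathbb{C}$ be locally integrable, and let $(A(u))_{u\in\Omega}$ be a $\mu$-measurable commuting family of self-adjoint (that is, real symmetric) $n\times n$ matrices that are nonsingular for $\mu$-almost every $u$ with $K(u)\neq 0$. Assume that $|\det A(u)|^{-1/2}K(u)\in L^1(\Omega,\mu)$. Then the Hausdorff operator $$(\mathcal{H}_{K,A}f)(x)=\int_\Omega K(u)\,f(A(u)x)\,d\mu(u)$$ is a well-defined bounded linear operator on $L^2(\mathbb{R}^n)$ (for every $f\in L^2(\mathbb{R}^n)$ the integral converges absolutely for almost every $x$), and if $\mathcal{H}_{K,A}\neq 0$, then $\mathcal{H}_{K,A}$ is not a compact operator on $L^2(\mathbb{R}^n)$. -/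

import Mathlib

open MeasureTheory

/-- The value at `x` of the Hausdorff operator with kernel `K` and matrix family `A` applied to
the function `f`, that is `∫ K(u) f(A(u) x) dμ(u)`. -/
noncomputable def hausdorffValue {Ω : Type*} [MeasurableSpace Ω] {n : ℕ} (μ : Measure Ω)
    (K : Ω → ℂ) (A : Ω → Matrix (Fin n) (Fin n) ℝ) (f : EuclideanSpace ℝ (Fin n) → ℂ)
    (x : EuclideanSpace ℝ (Fin n)) : ℂ :=
  ∫ u, K u * f (Matrix.toEuclideanLin (A u) x) ∂μ

/-- The bounded operator `T` on `L²(ℝⁿ)` is the Hausdorff operator with kernel `K` and matrix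
family `A`: for every square-integrable function `f` and almost every `x`, the defining integral
converges absolutely and its value is `(T f)(x)`. As `f` runs over functions, not classes, this
contains the independence of the representative; it determines `T`. -/
def IsHausdorffOperator {Ω : Type*} [MeasurableSpace Ω] {n : ℕ} (μ : Measure Ω)
    (K : Ω → ℂ) (A : Ω → Matrix (Fin n) (Fin n) ℝ)
    (T : Lp ℂ 2 (volume : Measure (EuclideanSpace ℝ (Fin n))) →L[ℂ]
      Lp ℂ 2 (volume : Measure (EuclideanSpace ℝ (Fin n)))) : Prop :=
  ∀ (f : EuclideanSpace ℝ (Fin n) → ℂ) (hf : MemLp f 2 volume),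
    ∀ᵐ x ∂(volume : Measure (EuclideanSpace ℝ (Fin n))),
      Integrable (fun u => K u * f (Matrix.toEuclideanLin (A u) x)) μ ∧
        T (hf.toLp f) x = hausdorffValue μ K A f x

open scoped ENNReal
open Filter Topology

/-! ### Weighted Cauchy–Schwarz, linear changes of variables, measurability. -/

section Auxiliary

variable {α : Type*} [MeasurableSpace α] {Ω : Type*} [MeasurableSpace Ω] {n : ℕ}

/-! Boundedness is a Schur-type estimate. Cauchy–Schwarz in `u` with weight `|det A(u)|^(-1/2)
|K(u)|`, then Tonelli and the substitution `y = A(u) x`, bounds the `L²` norm of the operator by the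
integral of that weight (`lintegral_sq_lintegral_le`).

Non-compactness comes from dilation invariance. Each `A(u)` is linear, so the operator `T` commutes
with the `L²` isometries `f ↦ r^(n/2) f(r ·)` (`hausdorffValue_unitaryDilation`). If `T` is compact,
the images of the dilates of `f` by `r = 1, 2, 3, ...` have a convergent subsequence. These images
are the dilates of `T f`, whose mass concentrates at the origin, so the limit is zero
(`eq_zero_of_tendsto_unitaryDilation`). Their norms all equal `‖T f‖`, hence `T f = 0`. -/

theorem enorm_complex_ofReal {t : ℝ} (ht : 0 ≤ t) : ‖(t : ℂ)‖ₑ = ENNReal.ofReal t := by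
  rw [← ofReal_norm, Complex.norm_real, Real.norm_of_nonneg ht]

theorem eLpNorm_two_sq {E : Type*} [NormedAddCommGroup E] (ν : Measure α) (f : α → E) :
    eLpNorm f 2 ν ^ 2 = ∫⁻ x, ‖f x‖ₑ ^ 2 ∂ν := by
  have h := eLpNorm_nnreal_pow_eq_lintegral (μ := ν) (f := f) (p := 2) (by norm_num)
  norm_num at h
  exact_mod_cast h

/-- Cauchy–Schwarz with a weight. -/
theorem sq_lintegral_mul_le {ν : Measure α} {w φ : α → ℝ≥0∞}
    (hw : AEMeasurable w ν) (hφ : AEMeasurable φ ν) :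
    (∫⁻ a, w a * φ a ∂ν) ^ 2 ≤ (∫⁻ a, w a ∂ν) * ∫⁻ a, w a * φ a ^ 2 ∂ν := by
  have hs : ∀ a : ℝ≥0∞, (a ^ (1 / 2 : ℝ)) ^ 2 = a := fun a => by
    rw [← ENNReal.rpow_natCast, ← ENNReal.rpow_mul]; norm_num
  have h := ENNReal.lintegral_mul_le_Lp_mul_Lq ν Real.HolderConjugate.two_two
    (hw.pow_const (1 / 2 : ℝ)) ((hw.pow_const (1 / 2 : ℝ)).mul hφ)
  have h1 : ∀ a, ((fun a => w a ^ (1 / 2 : ℝ)) * ((fun a => w a ^ (1 / 2 : ℝ)) * φ)) a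
      = w a * φ a := fun a => by
    simp only [Pi.mul_apply]
    rw [← mul_assoc, ← sq, hs]
  have h2 : ∀ a, (w a ^ (1 / 2 : ℝ)) ^ (2 : ℝ) = w a := fun a => by
    rw [ENNReal.rpow_two, hs]
  have h3 : ∀ a, (((fun a => w a ^ (1 / 2 : ℝ)) * φ) a) ^ (2 : ℝ) = w a * φ a ^ 2 := fun a => by
    rw [ENNReal.rpow_two, Pi.mul_apply, mul_pow, hs]
  simp only [h1, h2, h3] at h
  calc _ ≤ _ := pow_le_pow_left' h 2
    _ = _ := by rw [mul_pow, hs, hs]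

theorem map_volume_toEuclideanLin (B : Matrix (Fin n) (Fin n) ℝ) (hB : B.det ≠ 0) :
    Measure.map (Matrix.toEuclideanLin B) (volume : Measure (EuclideanSpace ℝ (Fin n))) =
      ENNReal.ofReal |B.det|⁻¹ • volume := by
  have h : LinearMap.det (Matrix.toEuclideanLin B) = B.det := by
    rw [show Matrix.toEuclideanLin B = Matrix.toLin (PiLp.basisFun 2 ℝ (Fin n))
      (PiLp.basisFun 2 ℝ (Fin n)) B from rfl, LinearMap.det_toLin]
  rw [Measure.map_linearMap_addHaar_eq_smul_addHaar _ (by rwa [h]), h, abs_inv]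

theorem measurable_toEuclideanLin (B : Matrix (Fin n) (Fin n) ℝ) :
    Measurable (Matrix.toEuclideanLin B) :=
  (Matrix.toEuclideanLin B).continuous_of_finiteDimensional.measurable

theorem quasiMeasurePreserving_toEuclideanLin (B : Matrix (Fin n) (Fin n) ℝ) (hB : B.det ≠ 0) :
    Measure.QuasiMeasurePreserving (Matrix.toEuclideanLin B)
      (volume : Measure (EuclideanSpace ℝ (Fin n))) volume :=
  ⟨measurable_toEuclideanLin B, by
    rw [map_volume_toEuclideanLin B hB]; exact Measure.smul_absolutelyContinuous⟩

theorem lintegral_comp_toEuclideanLin (B : Matrix (Fin n) (Fin n) ℝ) (hB : B.det ≠ 0)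
    {ψ : EuclideanSpace ℝ (Fin n) → ℝ≥0∞} (hψ : AEMeasurable ψ volume) :
    ∫⁻ x, ψ (Matrix.toEuclideanLin B x) = ENNReal.ofReal |B.det|⁻¹ * ∫⁻ x, ψ x := by
  rw [← smul_eq_mul, ← lintegral_smul_measure, ← map_volume_toEuclideanLin B hB, lintegral_map' _
    (measurable_toEuclideanLin B).aemeasurable]
  rw [map_volume_toEuclideanLin B hB]
  exact hψ.smul_measure _

theorem measurable_matrix_det {B : Ω → Matrix (Fin n) (Fin n) ℝ}
    (hB : ∀ i j, Measurable fun u => B u i j) : Measurable fun u => (B u).det := by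
  simp only [Matrix.det_apply]
  fun_prop

theorem measurable_uncurry_toEuclideanLin {B : Ω → Matrix (Fin n) (Fin n) ℝ}
    (hB : ∀ i j, Measurable fun u => B u i j) :
    Measurable fun p : EuclideanSpace ℝ (Fin n) × Ω => Matrix.toEuclideanLin (B p.2) p.1 := by
  refine (WithLp.measurable_toLp 2 (Fin n → ℝ)).comp (measurable_pi_lambda _ fun i => ?_)
  change Measurable fun p : EuclideanSpace ℝ (Fin n) × Ω => ∑ j, B p.2 i j * p.1 j
  refine Finset.measurable_sum _ fun j _ => ?_
  refine ((hB i j).comp measurable_snd).mul ?_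
  exact (measurable_pi_apply j).comp ((WithLp.measurable_ofLp 2 (Fin n → ℝ)).comp measurable_fst)

end Auxiliary

/-! ### Existence and boundedness of the operator. -/

section Bounded

variable {Ω : Type*} [MeasurableSpace Ω] {n : ℕ} {μ : Measure Ω} [SFinite μ]
  {K : Ω → ℂ} {A : Ω → Matrix (Fin n) (Fin n) ℝ}
  {f g : EuclideanSpace ℝ (Fin n) → ℂ}

theorem quasiMeasurePreserving_uncurry_toEuclideanLin
    (hA : ∀ i j, Measurable fun u => A u i j) (hdet : ∀ u, (A u).det ≠ 0) :
    Measure.QuasiMeasurePreserving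
      (fun p : EuclideanSpace ℝ (Fin n) × Ω => Matrix.toEuclideanLin (A p.2) p.1)
      (volume.prod μ) volume :=
  MeasureTheory.QuasiMeasurePreserving.prod_of_left (measurable_uncurry_toEuclideanLin hA)
    (.of_forall fun u => quasiMeasurePreserving_toEuclideanLin (A u) (hdet u))

theorem aestronglyMeasurable_hausdorff_integrand (hK : AEStronglyMeasurable K μ)
    (hA : ∀ i j, Measurable fun u => A u i j) (hdet : ∀ u, (A u).det ≠ 0)
    (hf : AEStronglyMeasurable f volume) :
    AEStronglyMeasurable (fun p : EuclideanSpace ℝ (Fin n) × Ω =>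
      K p.2 * f (Matrix.toEuclideanLin (A p.2) p.1)) (volume.prod μ) :=
  hK.comp_snd.mul
    (hf.comp_quasiMeasurePreserving (quasiMeasurePreserving_uncurry_toEuclideanLin hA hdet))

/-- Pullback under `(x, u) ↦ A(u) x` keeps null sets null, so Fubini applies to the exceptional set.
This makes the operator well defined on classes. -/
theorem hausdorffValue_congr (hA : ∀ i j, Measurable fun u => A u i j)
    (hdet : ∀ u, (A u).det ≠ 0) (h : f =ᵐ[volume] g) :
    hausdorffValue μ K A f =ᵐ[volume] hausdorffValue μ K A g := by
  have h2 := Measure.ae_ae_of_ae_prod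
    ((quasiMeasurePreserving_uncurry_toEuclideanLin (μ := μ) hA hdet).ae h)
  filter_upwards [h2] with x hx
  refine integral_congr_ae ?_
  filter_upwards [hx] with u hu
  rw [hu]

/-- The square of `|det B|^(-1/2)` is the Jacobian factor of `B`. -/
theorem ofReal_abs_rpow_neg_half_sq {d : ℝ} :
    ENNReal.ofReal (|d| ^ (-(1 / 2) : ℝ)) ^ 2 = ENNReal.ofReal |d|⁻¹ := by
  rw [← ENNReal.ofReal_pow (by positivity), ← Real.rpow_natCast, ← Real.rpow_mul (abs_nonneg d)]
  norm_num [Real.rpow_neg_one]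

theorem lintegral_sq_lintegral_le (hK : AEStronglyMeasurable K μ)
    (hA : ∀ i j, Measurable fun u => A u i j) (hdet : ∀ u, (A u).det ≠ 0)
    (hf : AEStronglyMeasurable f volume) :
    ∫⁻ x, (∫⁻ u, ‖K u * f (Matrix.toEuclideanLin (A u) x)‖ₑ ∂μ) ^ 2 ≤
      (∫⁻ u, ENNReal.ofReal (|(A u).det| ^ (-(1 / 2) : ℝ)) * ‖K u‖ₑ ∂μ) ^ 2 *
        ∫⁻ x, ‖f x‖ₑ ^ 2 := by
  set d : Ω → ℝ≥0∞ := fun u => ENNReal.ofReal (|(A u).det| ^ (-(1 / 2) : ℝ)) with hd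
  have hd0 : ∀ u, d u ≠ 0 := fun u => by
    have := abs_pos.2 (hdet u)
    simp only [hd, ne_eq, ENNReal.ofReal_eq_zero, not_le]
    positivity
  have hdt : ∀ u, d u ≠ ∞ := fun u => ENNReal.ofReal_ne_top
  have hdm : Measurable d := by
    have := measurable_matrix_det hA
    fun_prop
  have hcomp : AEStronglyMeasurable (fun p : EuclideanSpace ℝ (Fin n) × Ω =>
      f (Matrix.toEuclideanLin (A p.2) p.1)) (volume.prod μ) :=
    hf.comp_quasiMeasurePreserving (quasiMeasurePreserving_uncurry_toEuclideanLin hA hdet)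
  have hwm : AEMeasurable (fun u => d u * ‖K u‖ₑ) μ := hdm.aemeasurable.mul hK.enorm
  -- Dividing `f` by `d` compensates for the weight; after squaring, `(d u)⁻¹ ^ 2` cancels the
  -- Jacobian `d u ^ 2`.
  have hpt : ∀ᵐ x : EuclideanSpace ℝ (Fin n),
      (∫⁻ u, ‖K u * f (Matrix.toEuclideanLin (A u) x)‖ₑ ∂μ) ^ 2 ≤
        (∫⁻ u, d u * ‖K u‖ₑ ∂μ) * ∫⁻ u, (d u * ‖K u‖ₑ) *
          (‖f (Matrix.toEuclideanLin (A u) x)‖ₑ * (d u)⁻¹) ^ 2 ∂μ := by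
    filter_upwards [hcomp.prodMk_left] with x hx
    refine le_trans (le_of_eq ?_) (sq_lintegral_mul_le hwm
      (hx.enorm.mul hdm.inv.aemeasurable))
    congr 1
    refine lintegral_congr fun u => ?_
    rw [enorm_mul]
    calc _ = (d u * (d u)⁻¹) * (‖K u‖ₑ * ‖f (Matrix.toEuclideanLin (A u) x)‖ₑ) := by
          rw [ENNReal.mul_inv_cancel (hd0 u) (hdt u), one_mul]
      _ = _ := by ring
  have hjm : AEMeasurable (fun p : EuclideanSpace ℝ (Fin n) × Ω => (d p.2 * ‖K p.2‖ₑ) *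
      (‖f (Matrix.toEuclideanLin (A p.2) p.1)‖ₑ * (d p.2)⁻¹) ^ 2) (volume.prod μ) :=
    hwm.comp_snd.mul ((hcomp.enorm.mul (hdm.comp measurable_snd).inv.aemeasurable).pow_const 2)
  refine (lintegral_mono_ae hpt).trans ?_
  rw [lintegral_const_mul'' _ hjm.lintegral_prod_right', sq, mul_assoc]
  gcongr
  rw [lintegral_lintegral_swap hjm, ← lintegral_mul_const'' _ hwm]
  refine le_of_eq (lintegral_congr fun u => ?_)
  simp only [mul_pow]
  have hq : AEMeasurable (fun x => ‖f (Matrix.toEuclideanLin (A u) x)‖ₑ ^ 2) volume :=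
    (hf.comp_quasiMeasurePreserving
      (quasiMeasurePreserving_toEuclideanLin (A u) (hdet u))).enorm.pow_const 2
  rw [lintegral_const_mul'' _ (hq.mul_const _), lintegral_mul_const'' _ hq,
    lintegral_comp_toEuclideanLin (A u) (hdet u) (hf.enorm.pow_const 2),
    ← ofReal_abs_rpow_neg_half_sq]
  have hc : d u ^ 2 * ((d u)⁻¹) ^ 2 = 1 := by
    rw [← mul_pow, ENNReal.mul_inv_cancel (hd0 u) (hdt u), one_pow]
  calc _ = d u * ‖K u‖ₑ * (d u ^ 2 * ((d u)⁻¹) ^ 2 * ∫⁻ x, ‖f x‖ₑ ^ 2) := by ring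
    _ = _ := by rw [hc, one_mul]

theorem ae_integrable_hausdorff_integrand (hK : AEStronglyMeasurable K μ)
    (hA : ∀ i j, Measurable fun u => A u i j) (hdet : ∀ u, (A u).det ≠ 0)
    (hfin : ∫⁻ u, ENNReal.ofReal (|(A u).det| ^ (-(1 / 2) : ℝ)) * ‖K u‖ₑ ∂μ ≠ ∞)
    (hf : MemLp f 2 volume) :
    ∀ᵐ x, Integrable (fun u => K u * f (Matrix.toEuclideanLin (A u) x)) μ := by
  have hm := aestronglyMeasurable_hausdorff_integrand hK hA hdet hf.1
  have hlt : ∫⁻ x, (∫⁻ u, ‖K u * f (Matrix.toEuclideanLin (A u) x)‖ₑ ∂μ) ^ 2 ≠ ∞ := by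
    refine ne_top_of_le_ne_top ?_ (lintegral_sq_lintegral_le hK hA hdet hf.1)
    rw [← eLpNorm_two_sq]
    exact ENNReal.mul_ne_top (ENNReal.pow_ne_top hfin) (ENNReal.pow_ne_top hf.2.ne)
  filter_upwards [ae_lt_top' (hm.enorm.lintegral_prod_right'.pow_const 2) hlt, hm.prodMk_left]
    with x hx hxm
  refine ⟨hxm, ?_⟩
  by_contra hcon
  rw [HasFiniteIntegral, not_lt, top_le_iff] at hcon
  rw [hcon] at hx
  simp at hx

theorem eLpNorm_hausdorffValue_le (hK : AEStronglyMeasurable K μ)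
    (hA : ∀ i j, Measurable fun u => A u i j) (hdet : ∀ u, (A u).det ≠ 0)
    (hf : AEStronglyMeasurable f volume) :
    eLpNorm (hausdorffValue μ K A f) 2 volume ≤
      (∫⁻ u, ENNReal.ofReal (|(A u).det| ^ (-(1 / 2) : ℝ)) * ‖K u‖ₑ ∂μ) *
        eLpNorm f 2 volume := by
  refine (ENNReal.pow_right_strictMono two_ne_zero).le_iff_le.1 ?_
  beta_reduce
  rw [mul_pow, eLpNorm_two_sq, eLpNorm_two_sq]
  refine le_trans (lintegral_mono fun x => ?_) (lintegral_sq_lintegral_le hK hA hdet hf)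
  exact pow_le_pow_left' (enorm_integral_le_lintegral_enorm _) 2

theorem memLp_hausdorffValue (hK : AEStronglyMeasurable K μ)
    (hA : ∀ i j, Measurable fun u => A u i j) (hdet : ∀ u, (A u).det ≠ 0)
    (hfin : ∫⁻ u, ENNReal.ofReal (|(A u).det| ^ (-(1 / 2) : ℝ)) * ‖K u‖ₑ ∂μ ≠ ∞)
    (hf : MemLp f 2 volume) : MemLp (hausdorffValue μ K A f) 2 volume :=
  ⟨(aestronglyMeasurable_hausdorff_integrand hK hA hdet hf.1).integral_prod_right',
    (eLpNorm_hausdorffValue_le hK hA hdet hf.1).trans_lt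
      (ENNReal.mul_ne_top hfin hf.2.ne).lt_top⟩

theorem exists_isHausdorffOperator_of_measurable (hK : AEStronglyMeasurable K μ)
    (hA : ∀ i j, Measurable fun u => A u i j) (hdet : ∀ u, (A u).det ≠ 0)
    (hfin : ∫⁻ u, ENNReal.ofReal (|(A u).det| ^ (-(1 / 2) : ℝ)) * ‖K u‖ₑ ∂μ ≠ ∞) :
    ∃ T : Lp ℂ 2 (volume : Measure (EuclideanSpace ℝ (Fin n))) →L[ℂ]
        Lp ℂ 2 (volume : Measure (EuclideanSpace ℝ (Fin n))), IsHausdorffOperator μ K A T := by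
  have hmem := fun f : Lp ℂ 2 (volume : Measure (EuclideanSpace ℝ (Fin n))) =>
    memLp_hausdorffValue hK hA hdet hfin (Lp.memLp f)
  have hint := fun f : Lp ℂ 2 (volume : Measure (EuclideanSpace ℝ (Fin n))) =>
    ae_integrable_hausdorff_integrand hK hA hdet hfin (Lp.memLp f)
  let L : Lp ℂ 2 (volume : Measure (EuclideanSpace ℝ (Fin n))) →ₗ[ℂ]
      Lp ℂ 2 (volume : Measure (EuclideanSpace ℝ (Fin n))) :=
    { toFun := fun f => (hmem f).toLp _
      map_add' := fun f g => by
        rw [← MemLp.toLp_add, MemLp.toLp_eq_toLp_iff]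
        refine (hausdorffValue_congr hA hdet (Lp.coeFn_add f g)).trans ?_
        filter_upwards [hint f, hint g] with x hf hg
        simp only [hausdorffValue, Pi.add_apply, mul_add]
        exact integral_add hf hg
      map_smul' := fun c f => by
        rw [RingHom.id_apply, ← MemLp.toLp_const_smul, MemLp.toLp_eq_toLp_iff]
        refine (hausdorffValue_congr hA hdet (Lp.coeFn_smul c f)).trans (.of_forall fun x => ?_)
        simp only [hausdorffValue, Pi.smul_apply, smul_eq_mul, mul_left_comm _ c]
        exact integral_const_mul _ _ }
  refine ⟨L.mkContinuous (∫⁻ u, ENNReal.ofReal (|(A u).det| ^ (-(1 / 2) : ℝ)) * ‖K u‖ₑ ∂μ).toReal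
    fun f => ?_, fun f hf => ?_⟩
  · change ‖(hmem f).toLp _‖ ≤ _
    rw [Lp.norm_toLp, Lp.norm_def, ← ENNReal.toReal_mul]
    exact ENNReal.toReal_mono (ENNReal.mul_ne_top hfin (Lp.memLp f).2.ne)
      (eLpNorm_hausdorffValue_le hK hA hdet (Lp.memLp f).1)
  · filter_upwards [ae_integrable_hausdorff_integrand hK hA hdet hfin hf,
      (hmem (hf.toLp f)).coeFn_toLp,
      hausdorffValue_congr (μ := μ) (K := K) hA hdet hf.coeFn_toLp] with x h1 h2 h3
    exact ⟨h1, h2.trans h3⟩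

/-- Where `K` vanishes the integrand does not see `A`, so the matrices may be altered there. -/
theorem IsHausdorffOperator.congr_ae {μ : Measure Ω} {K' : Ω → ℂ}
    {A' : Ω → Matrix (Fin n) (Fin n) ℝ}
    {T : Lp ℂ 2 (volume : Measure (EuclideanSpace ℝ (Fin n))) →L[ℂ]
        Lp ℂ 2 (volume : Measure (EuclideanSpace ℝ (Fin n)))}
    (hT : IsHausdorffOperator μ K A T) (h : ∀ᵐ u ∂μ, K u = K' u ∧ (K u ≠ 0 → A u = A' u)) :
    IsHausdorffOperator μ K' A' T := by
  intro f hf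
  filter_upwards [hT f hf] with x hx
  have he : (fun u => K u * f (Matrix.toEuclideanLin (A u) x)) =ᵐ[μ]
      fun u => K' u * f (Matrix.toEuclideanLin (A' u) x) := by
    filter_upwards [h] with u hu
    by_cases h0 : K u = 0
    · simp [← hu.1, h0]
    · rw [← hu.1, hu.2 h0]
  exact ⟨hx.1.congr he, hx.2.trans (integral_congr_ae he)⟩

theorem exists_isHausdorffOperator (hA : ∀ i j, AEMeasurable (fun u => A u i j) μ)
    (hdet : ∀ᵐ u ∂μ, K u ≠ 0 → (A u).det ≠ 0)
    (hKA : Integrable (fun u => ((|(A u).det| ^ (-(1 / 2) : ℝ) : ℝ) : ℂ) * K u) μ) :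
    ∃ T : Lp ℂ 2 (volume : Measure (EuclideanSpace ℝ (Fin n))) →L[ℂ]
        Lp ℂ 2 (volume : Measure (EuclideanSpace ℝ (Fin n))), IsHausdorffOperator μ K A T := by
  classical
  let B : Ω → Matrix (Fin n) (Fin n) ℝ := fun u => Matrix.of fun i j => (hA i j).mk _ u
  have hB : ∀ i j, Measurable fun u => B u i j := fun i j => (hA i j).measurable_mk
  have hAB : ∀ᵐ u ∂μ, A u = B u := by
    have : ∀ᵐ u ∂μ, ∀ i j, A u i j = B u i j :=
      ae_all_iff.2 fun i => ae_all_iff.2 fun j => (hA i j).ae_eq_mk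
    filter_upwards [this] with u hu
    ext i j
    exact hu i j
  have hBd := measurable_matrix_det hB
  -- Singular values matter only where `K = 0`, up to a null set; the identity replaces them, giving
  -- a measurable family invertible everywhere.
  let A' : Ω → Matrix (Fin n) (Fin n) ℝ := fun u => if (B u).det = 0 then 1 else B u
  have hA' : ∀ i j, Measurable fun u => A' u i j := fun i j => by
    have : (fun u => A' u i j) =
        fun u => if (B u).det = 0 then (1 : Matrix (Fin n) (Fin n) ℝ) i j else B u i j := by
      funext u
      simp only [A']
      split_ifs <;> rfl
    rw [this]
    exact Measurable.ite (hBd (measurableSet_singleton 0)) measurable_const (hB i j)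
  have hdet' : ∀ u, (A' u).det ≠ 0 := fun u => by
    simp only [A']
    split_ifs with h
    · simp
    · exact h
  have hAA' : ∀ᵐ u ∂μ, K u ≠ 0 → A' u = A u := by
    filter_upwards [hAB, hdet] with u h1 h2 h3
    simp only [A', ← h1, if_neg (h2 h3)]
  have hKA' : Integrable (fun u => ((|(A' u).det| ^ (-(1 / 2) : ℝ) : ℝ) : ℂ) * K u) μ := by
    refine hKA.congr ?_
    filter_upwards [hAA'] with u hu
    by_cases h0 : K u = 0
    · simp [h0]
    · rw [hu h0]
  have hd' := measurable_matrix_det hA'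
  -- Divide the integrable product by its nonvanishing determinant factor.
  have hK : AEStronglyMeasurable K μ := by
    have hm : Measurable fun u => ((|(A' u).det| ^ (-(1 / 2) : ℝ) : ℝ) : ℂ)⁻¹ := by fun_prop
    refine (hm.aestronglyMeasurable.mul hKA'.1).congr (.of_forall fun u => ?_)
    have h0 : ((|(A' u).det| ^ (-(1 / 2) : ℝ) : ℝ) : ℂ) ≠ 0 := by
      have := abs_pos.2 (hdet' u)
      exact_mod_cast (by positivity : |(A' u).det| ^ (-(1 / 2) : ℝ) ≠ 0)
    exact inv_mul_cancel_left₀ h0 _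
  have hfin : ∫⁻ u, ENNReal.ofReal (|(A' u).det| ^ (-(1 / 2) : ℝ)) * ‖K u‖ₑ ∂μ ≠ ∞ := by
    refine ne_of_eq_of_ne (lintegral_congr fun u => ?_) hKA'.2.ne
    rw [enorm_mul, enorm_complex_ofReal (by positivity)]
  obtain ⟨T, hT⟩ := exists_isHausdorffOperator_of_measurable hK hA' hdet' hfin
  refine ⟨T, hT.congr_ae ?_⟩
  filter_upwards [hAA'] with u hu using ⟨rfl, hu⟩

end Bounded

/-! ### Unitary dilations and their concentration at the origin. -/

section Dilation

variable {n : ℕ}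

/-- The dilation of `g` by the factor `r`, normalised to preserve the `L²` norm for `0 < r`. -/
noncomputable def unitaryDilation (r : ℝ) (g : EuclideanSpace ℝ (Fin n) → ℂ) :
    EuclideanSpace ℝ (Fin n) → ℂ :=
  fun x => ((r ^ ((n : ℝ) / 2) : ℝ) : ℂ) * g (r • x)

variable {r : ℝ} {f g : EuclideanSpace ℝ (Fin n) → ℂ}

theorem quasiMeasurePreserving_const_smul (hr : 0 < r) :
    Measure.QuasiMeasurePreserving (fun x : EuclideanSpace ℝ (Fin n) => r • x) volume volume :=
  ⟨measurable_const_smul r, by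
    rw [Measure.map_addHaar_smul _ hr.ne']; exact Measure.smul_absolutelyContinuous⟩

theorem lintegral_unitaryDilation_sq (hr : 0 < r) (hg : AEStronglyMeasurable g volume)
    {s : Set (EuclideanSpace ℝ (Fin n))} (hs : MeasurableSet s) :
    ∫⁻ x in (fun x => r • x) ⁻¹' s, ‖unitaryDilation r g x‖ₑ ^ 2 = ∫⁻ x in s, ‖g x‖ₑ ^ 2 := by
  have hq : ∀ x, ‖unitaryDilation r g x‖ₑ ^ 2 = ENNReal.ofReal (r ^ n) * ‖g (r • x)‖ₑ ^ 2 := by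
    intro x
    rw [unitaryDilation, enorm_mul, mul_pow, enorm_complex_ofReal (by positivity),
      ← ENNReal.ofReal_pow (by positivity),
      ← Real.rpow_natCast, ← Real.rpow_mul hr.le]
    congr 2
    rw [← Real.rpow_natCast]
    congr 1
    push_cast
    ring
  have hmp : Measurable fun x : EuclideanSpace ℝ (Fin n) => r • x := measurable_const_smul r
  have hgs : AEMeasurable (s.indicator fun x => ‖g x‖ₑ ^ 2) volume :=
    (hg.enorm.pow_const 2).indicator hs
  have hmap := Measure.map_addHaar_smul (volume : Measure (EuclideanSpace ℝ (Fin n))) hr.ne'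
  have hgc : AEMeasurable (s.indicator fun x => ‖g x‖ₑ ^ 2)
      (Measure.map (fun x => r • x) volume) := by
    rw [hmap]; exact hgs.smul_measure _
  simp only [hq]
  rw [lintegral_const_mul' _ _ ENNReal.ofReal_ne_top, ← lintegral_indicator (hmp hs),
    ← lintegral_indicator hs]
  have h := lintegral_map' hgc hmp.aemeasurable
  rw [hmap, lintegral_smul_measure, finrank_euclideanSpace_fin] at h
  have hi : ∀ x, ((fun x => r • x) ⁻¹' s).indicator (fun x => ‖g (r • x)‖ₑ ^ 2) x =
      s.indicator (fun x => ‖g x‖ₑ ^ 2) (r • x) := fun x => rfl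
  simp only [hi]
  rw [← h, smul_eq_mul, ← mul_assoc, ← ENNReal.ofReal_mul (by positivity),
    abs_of_pos (by positivity), mul_inv_cancel₀ (by positivity), ENNReal.ofReal_one, one_mul]

theorem eLpNorm_unitaryDilation_restrict (hr : 0 < r) (hg : AEStronglyMeasurable g volume)
    {s : Set (EuclideanSpace ℝ (Fin n))} (hs : MeasurableSet s) :
    eLpNorm (unitaryDilation r g) 2 (volume.restrict ((fun x => r • x) ⁻¹' s)) =
      eLpNorm g 2 (volume.restrict s) := by
  refine (ENNReal.pow_right_strictMono two_ne_zero).injective ?_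
  simp only [eLpNorm_two_sq]
  exact lintegral_unitaryDilation_sq hr hg hs

theorem eLpNorm_unitaryDilation (hr : 0 < r) (hg : AEStronglyMeasurable g volume) :
    eLpNorm (unitaryDilation r g) 2 volume = eLpNorm g 2 volume := by
  simpa using eLpNorm_unitaryDilation_restrict hr hg MeasurableSet.univ

theorem memLp_unitaryDilation (hr : 0 < r) (hg : MemLp g 2 volume) :
    MemLp (unitaryDilation r g) 2 volume :=
  ⟨(hg.1.comp_quasiMeasurePreserving (quasiMeasurePreserving_const_smul hr)).const_mul _, by
    rw [eLpNorm_unitaryDilation hr hg.1]; exact hg.2⟩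

theorem unitaryDilation_congr (hr : 0 < r) (h : f =ᵐ[volume] g) :
    unitaryDilation r f =ᵐ[volume] unitaryDilation r g := by
  filter_upwards [(quasiMeasurePreserving_const_smul hr).ae h] with x hx
  simp only [unitaryDilation, hx]

theorem hausdorffValue_unitaryDilation {Ω : Type*} [MeasurableSpace Ω] (μ : Measure Ω)
    (K : Ω → ℂ) (A : Ω → Matrix (Fin n) (Fin n) ℝ) (r : ℝ)
    (f : EuclideanSpace ℝ (Fin n) → ℂ) :
    hausdorffValue μ K A (unitaryDilation r f) = unitaryDilation r (hausdorffValue μ K A f) := by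
  funext x
  simp only [hausdorffValue, unitaryDilation, map_smul]
  rw [← integral_const_mul]
  exact integral_congr_ae (.of_forall fun u => mul_left_comm _ _ _)

/-- The tails of a square-integrable function tend to zero. -/
theorem tendsto_setLIntegral_norm_gt {φ : EuclideanSpace ℝ (Fin n) → ℝ≥0∞}
    (hφ : ∫⁻ x, φ x ≠ ∞) {R : ℝ} (hR : 0 < R) :
    Tendsto (fun m : ℕ => ∫⁻ x in {x | (m + 1) * R < ‖x‖}, φ x) atTop (𝓝 0) := by
  have hs : ∀ m : ℕ, MeasurableSet {x : EuclideanSpace ℝ (Fin n) | (m + 1) * R < ‖x‖} :=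
    fun m => measurableSet_lt measurable_const measurable_norm
  have hanti : Antitone fun m : ℕ => {x : EuclideanSpace ℝ (Fin n) | (m + 1) * R < ‖x‖} := by
    intro a b hab x hx
    simp only [Set.mem_ofPred_eq] at hx ⊢
    refine lt_of_le_of_lt ?_ hx
    gcongr
  have hempty : ⋂ m : ℕ, {x : EuclideanSpace ℝ (Fin n) | (m + 1) * R < ‖x‖} = ∅ := by
    refine Set.eq_empty_of_forall_notMem fun x hx => ?_
    obtain ⟨m, hm⟩ := exists_nat_gt (‖x‖ / R)
    have h1 : ((m : ℝ) + 1) * R < ‖x‖ := Set.mem_iInter.1 hx m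
    rw [div_lt_iff₀ hR] at hm
    linarith
  have h := tendsto_measure_iInter_atTop (μ := volume.withDensity φ)
    (fun m => (hs m).nullMeasurableSet) hanti
    ⟨0, by
      rw [withDensity_apply _ (hs 0)]
      exact ne_top_of_le_ne_top hφ (setLIntegral_le_lintegral _ _)⟩
  rw [hempty, measure_empty] at h
  refine h.congr fun m => ?_
  rw [Function.comp_apply, withDensity_apply _ (hs m)]

theorem tendsto_eLpNorm_unitaryDilation_restrict (hg : MemLp g 2 volume) {R : ℝ} (hR : 0 < R) :
    Tendsto (fun m : ℕ => eLpNorm (unitaryDilation ((m : ℝ) + 1) g) 2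
      (volume.restrict {x | R < ‖x‖})) atTop (𝓝 0) := by
  have hfin : ∫⁻ x, ‖g x‖ₑ ^ 2 ≠ ∞ := by
    rw [← eLpNorm_two_sq]; exact ENNReal.pow_ne_top hg.2.ne
  have h := (ENNReal.continuous_rpow_const (y := (1 / 2 : ℝ))).continuousAt.tendsto.comp
    (tendsto_setLIntegral_norm_gt hfin hR)
  rw [ENNReal.zero_rpow_of_pos (by norm_num)] at h
  refine h.congr fun m => ?_
  have hm : (0 : ℝ) < m + 1 := by positivity
  have hpre : {x : EuclideanSpace ℝ (Fin n) | R < ‖x‖} =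
      (fun x => ((m : ℝ) + 1) • x) ⁻¹' {x | (m + 1) * R < ‖x‖} := by
    ext x
    simp [norm_smul, abs_of_pos hm, hm]
  rw [hpre, eLpNorm_unitaryDilation_restrict hm hg.1
    (measurableSet_lt measurable_const measurable_norm), Function.comp_apply, ← eLpNorm_two_sq,
    ← ENNReal.rpow_natCast, ← ENNReal.rpow_mul]
  norm_num

/-- The `L²` limit of a subsequence of unitary dilations of a fixed function vanishes. -/
theorem eq_zero_of_tendsto_unitaryDilation (hn : 1 ≤ n) (hg : MemLp g 2 volume)
    {h : Lp ℂ 2 (volume : Measure (EuclideanSpace ℝ (Fin n)))} {φ : ℕ → ℕ}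
    (hφ : StrictMono φ)
    {G : ℕ → Lp ℂ 2 (volume : Measure (EuclideanSpace ℝ (Fin n)))}
    (hG : ∀ m, G m =ᵐ[volume] unitaryDilation ((m : ℝ) + 1) g)
    (hlim : Tendsto (G ∘ φ) atTop (𝓝 h)) : h = 0 := by
  have hdist : Tendsto (fun j => eLpNorm (⇑h - ⇑(G (φ j))) 2 volume) atTop (𝓝 0) := by
    have h1 := (Lp.tendsto_Lp_iff_tendsto_eLpNorm' (G ∘ φ) h).1 hlim
    refine h1.congr fun j => ?_
    rw [eLpNorm_sub_comm]
    rfl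
  -- Off the ball of radius `R`, `h` is bounded by its distance to `G (φ j)` plus the tail of `G (φ
  -- j)`; both tend to zero.
  have hzero : ∀ R : ℝ, 0 < R →
      eLpNorm h 2 (volume.restrict {x : EuclideanSpace ℝ (Fin n) | R < ‖x‖}) = 0 := by
    intro R hR
    have hsum := hdist.add
      ((tendsto_eLpNorm_unitaryDilation_restrict hg hR).comp hφ.tendsto_atTop)
    rw [add_zero] at hsum
    refine le_antisymm (ge_of_tendsto' hsum fun j => ?_) zero_le
    have hsplit : (h : EuclideanSpace ℝ (Fin n) → ℂ) = (⇑h - ⇑(G (φ j))) + ⇑(G (φ j)) :=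
      (sub_add_cancel _ _).symm
    calc eLpNorm h 2 (volume.restrict {x | R < ‖x‖})
        ≤ eLpNorm (⇑h - ⇑(G (φ j))) 2 (volume.restrict {x | R < ‖x‖}) +
          eLpNorm (G (φ j)) 2 (volume.restrict {x | R < ‖x‖}) := by
          conv_lhs => rw [hsplit]
          exact eLpNorm_add_le ((Lp.aestronglyMeasurable h).sub
            (Lp.aestronglyMeasurable (G (φ j)))).restrict
            (Lp.aestronglyMeasurable (G (φ j))).restrict (by norm_num)
      _ ≤ _ := add_le_add (eLpNorm_mono_measure _ Measure.restrict_le_self)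
          (eLpNorm_congr_ae (ae_restrict_of_ae (hG (φ j)))).le
  have hae : ∀ᵐ x : EuclideanSpace ℝ (Fin n), ∀ k : ℕ, 1 / ((k : ℝ) + 1) < ‖x‖ → h x = 0 := by
    refine ae_all_iff.2 fun k => ?_
    have h1 := hzero (1 / ((k : ℝ) + 1)) (by positivity)
    rw [eLpNorm_eq_zero_iff (Lp.aestronglyMeasurable h).restrict (by norm_num)] at h1
    exact (ae_restrict_iff' (measurableSet_lt measurable_const measurable_norm)).1 h1
  -- Positive dimension makes the origin a null set.
  have : Nonempty (Fin n) := ⟨⟨0, hn⟩⟩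
  have hne : ∀ᵐ x : EuclideanSpace ℝ (Fin n), x ≠ 0 := Measure.ae_ne volume 0
  rw [Lp.eq_zero_iff_ae_eq_zero]
  filter_upwards [hae, hne] with x hx hx0
  obtain ⟨k, hk⟩ := exists_nat_one_div_lt (norm_pos_iff.2 hx0)
  exact hx k hk

end Dilation

/-! ### Compactness forces the operator to vanish. -/

theorem IsHausdorffOperator.eq_zero_of_isCompactOperator {Ω : Type*} [MeasurableSpace Ω] {n : ℕ}
    (hn : 1 ≤ n) {μ : Measure Ω} {K : Ω → ℂ} {A : Ω → Matrix (Fin n) (Fin n) ℝ}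
    {T : Lp ℂ 2 (volume : Measure (EuclideanSpace ℝ (Fin n))) →L[ℂ]
        Lp ℂ 2 (volume : Measure (EuclideanSpace ℝ (Fin n)))}
    (hT : IsHausdorffOperator μ K A T) (hc : IsCompactOperator T) : T = 0 := by
  ext1 f
  rw [zero_apply]
  have hpos : ∀ m : ℕ, (0 : ℝ) < m + 1 := fun m => by positivity
  have hfm := fun m => memLp_unitaryDilation (hpos m) (Lp.memLp f)
  have hTf : T f =ᵐ[volume] hausdorffValue μ K A f := by
    filter_upwards [hT f (Lp.memLp f)] with x hx
    rw [← hx.2, Lp.toLp_coeFn]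
  have hG : ∀ m, T ((hfm m).toLp _) =ᵐ[volume] unitaryDilation ((m : ℝ) + 1) (T f) := by
    intro m
    filter_upwards [hT _ (hfm m), unitaryDilation_congr (hpos m) hTf] with x hx h2
    rw [hx.2, h2, hausdorffValue_unitaryDilation]
  -- All dilates of `f` have norm `‖f‖`, so this ball contains them.
  have hcpt := IsCompactOperator.isCompact_closure_image_closedBall
    (f := (T : Lp ℂ 2 (volume : Measure (EuclideanSpace ℝ (Fin n))) →ₗ[ℂ]
      Lp ℂ 2 (volume : Measure (EuclideanSpace ℝ (Fin n))))) hc ‖f‖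
  obtain ⟨h, -, φ, hφ, hlim⟩ := hcpt.tendsto_subseq (x := fun m => T ((hfm m).toLp _))
    fun m => subset_closure ⟨_, by
      rw [mem_closedBall_zero_iff, Lp.norm_toLp,
        eLpNorm_unitaryDilation (hpos m) (Lp.memLp f).1, Lp.norm_def], rfl⟩
  have hh := eq_zero_of_tendsto_unitaryDilation hn (Lp.memLp (T f)) hφ hG hlim
  have hnorm : ∀ m, ‖T ((hfm m).toLp _)‖ = ‖T f‖ := fun m => by
    rw [Lp.norm_def, eLpNorm_congr_ae (hG m),
      eLpNorm_unitaryDilation (hpos m) (Lp.memLp (T f)).1, Lp.norm_def]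
  have h1 := hlim.norm
  simp only [Function.comp_apply, hnorm, hh, norm_zero] at h1
  exact norm_eq_zero.1 (tendsto_nhds_unique tendsto_const_nhds h1)

theorem corollary6 {Ω : Type*} [TopologicalSpace Ω] [SigmaCompactSpace Ω]
    [MeasurableSpace Ω] [BorelSpace Ω] (μ : Measure Ω) [μ.Regular]
    (n : ℕ) (hn : 1 ≤ n)
    (K : Ω → ℂ) (hK : LocallyIntegrable K μ)
    (A : Ω → Matrix (Fin n) (Fin n) ℝ)
    (hA_meas : ∀ i j, AEMeasurable (fun u => A u i j) μ)
    (hA_nonsing : ∀ᵐ u ∂μ, K u ≠ 0 → (A u).det ≠ 0)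
    (hA_selfadj : ∀ u, (A u).IsHermitian)
    (hA_comm : ∀ u v, Commute (A u) (A v))
    (hKA : Integrable (fun u => ((|(A u).det| ^ (-(1 / 2) : ℝ) : ℝ) : ℂ) * K u) μ) :
    ∃ T : Lp ℂ 2 (volume : Measure (EuclideanSpace ℝ (Fin n))) →L[ℂ]
        Lp ℂ 2 (volume : Measure (EuclideanSpace ℝ (Fin n))),
      IsHausdorffOperator μ K A T ∧ (T ≠ 0 → ¬ IsCompactOperator T) := by
  -- A regular measure is finite on compact sets, so σ-compactness supplies the s-finiteness needed
  -- for Tonelli.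
  obtain ⟨T, hT⟩ := exists_isHausdorffOperator hA_meas hA_nonsing hKA
  exact ⟨T, hT, fun h0 hc => h0 (hT.eq_zero_of_isCompactOperator hn hc)⟩
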